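/- Let $A\in\mathbb{R}^{n\times m}$, let $\Delta_k=\{p\in\mathbb{R}^k : p_i\ge 0,\ \sum_i p_i=1\}$ and let $\operatorname{int}\Delta_k=\{p\in\Delta_k : p_i>0 \text{ for all } i\}$. Call $(x,y)\in\Delta_n\times\Delta_m$ an optimal solution of the matrix game $\min_{y\in\Delta_m}\max_{x\in\Delta_n}x^\top Ay$ if $y$ attains $\min_{y\in\Delta_m}\max_{x\in\Delta_n}x^\top Ay$ and $x$ attains $\max_{x\in\Delta_n}\min_{y\in\Delta_m}x^\top Ay$; by the minimax theorem these are exactly the minimax equilibria. For a constant stepsize $\eta>0$, the Optimistic Multiplicative-Weights-Update (OMWU) dynamics with initial points $(x^0,y^0),(x^1,y^1)$ is, for $t\ge 1$, $$x_i^{t+1}=x_i^t\,\frac{e^{2\eta(Ay^t)_i-\eta(Ay^{t-1})_i}}{\sum_{j=1}^n x_j^t e^{2\eta(Ay^t)_j-\eta(Ay^{t-1})_j}}\quad(1\le i\le n),\qquad y_i^{t+1}=y_i^t\,\frac{e^{-2\eta(A^\top x^t)_i+\eta(A^\top x^{t-1})_i}}{\sum_{j=1}^m y_j^t e^{-2\eta(A^\top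 x^t)_j+\eta(A^\top x^{t-1})_j}}\quad(1\le i\le m).$$ Suppose that the game has a unique optimal solution $(x^*,y^*)$. Then there is $\eta_0>0$, depending only on $n,m,A$, such that for every constant stepsize $0<\eta<\eta_0$ the OMWU dynamics started at $(x^0,y^0)=(x^1,y^1)=(\tfrac1n\mathbf{1},\tfrac1m\mathbf{1})$ satisfies $$\lim_{t\to\infty}(x^t,y^t)=(x^*,y^*).$$ Moreover, for all starting points $(x^0,y^0),(x^1,y^1)\in\operatorname{int}\Delta_n\times\operatorname{int}\Delta_m$ there is $\eta_0>0$, depending only on $n,m,A$ and the starting points, such that the same limit holds for every constant stepsize $0<\eta<\eta_0$. -/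

import Mathlib

open Filter Topology Matrix

noncomputable section

namespace OMWU

/-- The worst-case payment `max_{x ∈ Δ_n} xᵀ A y` of the min player when she plays `y`.
The maximum is over a compact set, so the supremum is attained whenever `Δ_n` is nonempty. -/
def maxPayoff {n m : ℕ} (A : Matrix (Fin n) (Fin m) ℝ) (y : Fin m → ℝ) : ℝ :=
  ⨆ x : stdSimplex ℝ (Fin n), (x : Fin n → ℝ) ⬝ᵥ (A *ᵥ y)

/-- The guaranteed payoff `min_{y ∈ Δ_m} xᵀ A y` of the max player when he plays `x`. -/
def minPayoff {n m : ℕ} (A : Matrix (Fin n) (Fin m) ℝ) (x : Fin n → ℝ) : ℝ :=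
  ⨅ y : stdSimplex ℝ (Fin m), x ⬝ᵥ (A *ᵥ (y : Fin m → ℝ))

/-- `(x, y)` is an optimal solution of the matrix game `min_y max_x xᵀ A y`: both are
probability vectors, `y` attains `min_y max_x xᵀ A y` and `x` attains `max_x min_y xᵀ A y`. -/
structure IsOptimal {n m : ℕ} (A : Matrix (Fin n) (Fin m) ℝ)
    (x : Fin n → ℝ) (y : Fin m → ℝ) : Prop where
  left_mem : x ∈ stdSimplex ℝ (Fin n)
  right_mem : y ∈ stdSimplex ℝ (Fin m)
  minimax : ∀ y' ∈ stdSimplex ℝ (Fin m), maxPayoff A y ≤ maxPayoff A y'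
  maximin : ∀ x' ∈ stdSimplex ℝ (Fin n), minPayoff A x' ≤ minPayoff A x

/-- Multiplicative reweighting: `p_i exp(u_i) / ∑_j p_j exp(u_j)`. -/
def reweight {k : ℕ} (p u : Fin k → ℝ) : Fin k → ℝ :=
  fun i => p i * Real.exp (u i) / ∑ j, p j * Real.exp (u j)

/-- One OMWU step: from the current pair `(x^t, y^t)` and the previous pair
`(x^{t-1}, y^{t-1})` to the next pair `(x^{t+1}, y^{t+1})`. -/
def step {n m : ℕ} (A : Matrix (Fin n) (Fin m) ℝ) (η : ℝ)
    (cur prev : (Fin n → ℝ) × (Fin m → ℝ)) : (Fin n → ℝ) × (Fin m → ℝ) :=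
  (reweight cur.1 (fun i => 2 * η * (A *ᵥ cur.2) i - η * (A *ᵥ prev.2) i),
   reweight cur.2 (fun j => -2 * η * (Aᵀ *ᵥ cur.1) j + η * (Aᵀ *ᵥ prev.1) j))

/-- The OMWU iterates `t ↦ (x^t, y^t)` with constant stepsize `η`, started from
`(x^0, y^0) = z0` and `(x^1, y^1) = z1`. -/
def iterate {n m : ℕ} (A : Matrix (Fin n) (Fin m) ℝ) (η : ℝ)
    (z0 z1 : (Fin n → ℝ) × (Fin m → ℝ)) : ℕ → (Fin n → ℝ) × (Fin m → ℝ)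
  | 0 => z0
  | 1 => z1
  | t + 2 => step A η (iterate A η z0 z1 (t + 1)) (iterate A η z0 z1 t)

/-- The uniform vector `(1/k, …, 1/k)`. -/
def uniform (k : ℕ) : Fin k → ℝ := fun _ => 1 / (k : ℝ)

/-- The (relative) interior of the probability simplex `Δ_k`. -/
def simplexInterior (k : ℕ) : Set (Fin k → ℝ) :=
  {p | p ∈ stdSimplex ℝ (Fin k) ∧ ∀ i, 0 < p i}

end OMWU

end

/-! With secondary iterates `Xh`, `Yh`, each obtained from the next iterate by undoing the last
payoff, OMWU becomes optimistic mirror ascent: a trial reweighting of `Xh t` by the old payoff gives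
`X (t + 1)`, and one by the new payoff gives `Xh (t + 1)`.

For η small relative to the entries of `A`, the cross entropy of the optimal pair against `(Xh,
Yh)`, plus an eighth of the squared distance from `(Xh, Yh)` to `(X, Y)`, decreases by at least a
multiple of the squared gaps between neighbouring iterates (`IsTwoSequence.potential_step`). Being
nonnegative, it converges, so the gaps vanish and every cluster point is fixed by its own
reweighting: rows in its support earn equal payoffs, and likewise columns. Boundedness of the cross
entropy keeps the coordinates in the optimal supports away from zero.

Such a point need not satisfy the inequalities off its support, so it is not obviously an
equilibrium. Here uniqueness enters through strict complementarity, a consequence of Farkas' lemma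
(`eq_of_indifferent`). By compactness the iterates converge. The starting points play no role in the
threshold. -/

namespace OMWU

/-! ### Linear programming duality -/

section Farkas

/-- **Farkas' lemma**: a linear functional that is nonnegative wherever the finitely many
functionals `a i` are all nonnegative is a nonnegative combination of them. -/
theorem farkas {ι V : Type*} [AddCommGroup V] [Module ℝ V] (s : Finset ι) :
    ∀ (a : ι → V →ₗ[ℝ] ℝ) (b : V →ₗ[ℝ] ℝ),
      (∀ x, (∀ i ∈ s, 0 ≤ a i x) → 0 ≤ b x) →
      ∃ c : ι → ℝ, (∀ i ∈ s, 0 ≤ c i) ∧ ∀ x, b x = ∑ i ∈ s, c i * a i x := by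
  classical
  induction s using Finset.induction_on with
  | empty =>
    intro a b h
    refine ⟨fun _ => 0, by simp, fun x => ?_⟩
    have h1 := h x (by simp)
    have h2 := h (-x) (by simp)
    simp only [map_neg] at h2
    simp only [Finset.sum_empty]
    linarith
  | insert k s hk ih =>
    intro a b h
    by_cases hb : ∀ x, (∀ i ∈ s, 0 ≤ a i x) → 0 ≤ b x
    · obtain ⟨c, hc, hbc⟩ := ih a b hb
      refine ⟨fun i => if i = k then 0 else c i, fun i hi => ?_, fun x => ?_⟩
      · rcases Finset.mem_insert.1 hi with rfl | hi
        · simp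
        · dsimp only
          split_ifs
          exacts [le_rfl, hc i hi]
      · rw [Finset.sum_insert hk, hbc x]
        simp only [if_true, zero_mul, zero_add]
        refine Finset.sum_congr rfl fun i hi => ?_
        rw [if_neg (ne_of_mem_of_not_mem hi hk)]
    · push Not at hb
      -- The functional `a k` must be negative at `w`, so moving along `w` projects onto the kernel
      -- of `a k`; there the induction hypothesis applies to the functionals composed with this
      -- projection.
      obtain ⟨w, hw, hbw⟩ := hb
      have hkw : a k w < 0 := by
        by_contra hcon
        push Not at hcon
        refine absurd (h w fun i hi => ?_) (not_le.2 hbw)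
        rcases Finset.mem_insert.1 hi with rfl | hi
        exacts [hcon, hw i hi]
      set d : ℝ := (-(a k w))⁻¹ with hd
      have hdpos : 0 < d := inv_pos.2 (by linarith)
      have hdk : d * a k w = -1 := by
        rw [hd, inv_neg, neg_mul, inv_mul_cancel₀ hkw.ne]
      have key : ∀ x, a k (x + (d * a k x) • w) = 0 := by
        intro x
        simp only [map_add, map_smul, smul_eq_mul]
        linear_combination (a k x) * hdk
      obtain ⟨c, hc, hbc⟩ := ih (fun i => a i + (d * a i w) • a k) (b + (d * b w) • a k) (by
        intro x hx
        have hx' := h (x + (d * a k x) • w) (fun i hi => by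
          rcases Finset.mem_insert.1 hi with rfl | hi
          · exact (key x).ge
          · have := hx i hi
            simp only [LinearMap.add_apply, LinearMap.smul_apply, map_add, map_smul,
              smul_eq_mul] at this ⊢
            linarith)
        simp only [LinearMap.add_apply, LinearMap.smul_apply, map_add, map_smul,
          smul_eq_mul] at hx' ⊢
        linarith)
      -- The coefficient of `a k` collects the multiples of `a k` that the projection introduced.
      refine ⟨fun i => if i = k then ∑ j ∈ s, c j * (d * a j w) - d * b w else c i,
        fun i hi => ?_, fun x => ?_⟩
      · rcases Finset.mem_insert.1 hi with rfl | hi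
        · simp only [if_true]
          have h1 : 0 ≤ ∑ j ∈ s, c j * (d * a j w) := Finset.sum_nonneg fun j hj =>
            mul_nonneg (hc j hj) (mul_nonneg hdpos.le (hw j hj))
          nlinarith
        · dsimp only
          rw [if_neg (ne_of_mem_of_not_mem hi hk)]
          exact hc i hi
      · rw [Finset.sum_insert hk]
        have h1 := hbc x
        simp only [LinearMap.add_apply, LinearMap.smul_apply, smul_eq_mul, mul_add,
          Finset.sum_add_distrib] at h1
        have h2 : ∑ i ∈ s, (if i = k then ∑ j ∈ s, c j * (d * a j w) - d * b w else c i) * a i x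
            = ∑ i ∈ s, c i * a i x := Finset.sum_congr rfl fun i hi => by
          rw [if_neg (ne_of_mem_of_not_mem hi hk)]
        have h3 : ∑ i ∈ s, c i * (d * a i w * a k x)
            = (∑ j ∈ s, c j * (d * a j w)) * a k x := by
          rw [Finset.sum_mul]
          exact Finset.sum_congr rfl fun i _ => by ring
        simp only [h2, if_true]
        rw [h3] at h1
        linarith

end Farkas

/-! ### Zero-sum games: value, strict complementarity, uniqueness -/

section Game

variable {n m : ℕ} {A : Matrix (Fin n) (Fin m) ℝ}

theorem dotProduct_le_of_mem_stdSimplex {k : ℕ} {p f : Fin k → ℝ} {v : ℝ}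
    (hp : p ∈ stdSimplex ℝ (Fin k)) (hf : ∀ i, f i ≤ v) : p ⬝ᵥ f ≤ v := by
  calc p ⬝ᵥ f = ∑ i, p i * f i := rfl
    _ ≤ ∑ i, p i * v := Finset.sum_le_sum fun i _ => mul_le_mul_of_nonneg_left (hf i) (hp.1 i)
    _ = v := by rw [← Finset.sum_mul, hp.2, one_mul]

theorem le_dotProduct_of_mem_stdSimplex {k : ℕ} {p f : Fin k → ℝ} {v : ℝ}
    (hp : p ∈ stdSimplex ℝ (Fin k)) (hf : ∀ i, v ≤ f i) : v ≤ p ⬝ᵥ f := by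
  calc v = ∑ i, p i * v := by rw [← Finset.sum_mul, hp.2, one_mul]
    _ ≤ ∑ i, p i * f i := Finset.sum_le_sum fun i _ => mul_le_mul_of_nonneg_left (hf i) (hp.1 i)
    _ = p ⬝ᵥ f := rfl

theorem dotProduct_mulVec_eq (A : Matrix (Fin n) (Fin m) ℝ) (x : Fin n → ℝ) (y : Fin m → ℝ) :
    x ⬝ᵥ (A *ᵥ y) = y ⬝ᵥ (Aᵀ *ᵥ x) := by
  rw [Matrix.dotProduct_mulVec, ← Matrix.mulVec_transpose, dotProduct_comm]

theorem bddAbove_payoff (A : Matrix (Fin n) (Fin m) ℝ) (y : Fin m → ℝ) :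
    BddAbove (Set.range fun x : stdSimplex ℝ (Fin n) => (x : Fin n → ℝ) ⬝ᵥ (A *ᵥ y)) := by
  refine ⟨∑ i, |(A *ᵥ y) i|, ?_⟩
  rintro _ ⟨x, rfl⟩
  exact dotProduct_le_of_mem_stdSimplex x.2 fun i => (le_abs_self _).trans
    (Finset.single_le_sum (f := fun i => |(A *ᵥ y) i|) (fun _ _ => abs_nonneg _)
      (Finset.mem_univ i))

theorem bddBelow_payoff (A : Matrix (Fin n) (Fin m) ℝ) (x : Fin n → ℝ) :
    BddBelow (Set.range fun y : stdSimplex ℝ (Fin m) => x ⬝ᵥ (A *ᵥ (y : Fin m → ℝ))) := by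
  refine ⟨-∑ j, |(Aᵀ *ᵥ x) j|, ?_⟩
  rintro _ ⟨y, rfl⟩
  dsimp only
  rw [dotProduct_mulVec_eq]
  exact le_dotProduct_of_mem_stdSimplex y.2 fun j => (neg_le_neg (Finset.single_le_sum
    (f := fun j => |(Aᵀ *ᵥ x) j|) (fun _ _ => abs_nonneg _) (Finset.mem_univ j))).trans
    (neg_abs_le _)

/-- Strategies guaranteeing a common value `v` to both players are optimal. -/
theorem IsOptimal.of_value {x : Fin n → ℝ} {y : Fin m → ℝ} {v : ℝ}
    (hx : x ∈ stdSimplex ℝ (Fin n)) (hy : y ∈ stdSimplex ℝ (Fin m))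
    (hv : ∀ i, (A *ᵥ y) i ≤ v) (hv' : ∀ j, v ≤ (Aᵀ *ᵥ x) j) : IsOptimal A x y := by
  have : Nonempty (stdSimplex ℝ (Fin n)) := ⟨⟨x, hx⟩⟩
  have : Nonempty (stdSimplex ℝ (Fin m)) := ⟨⟨y, hy⟩⟩
  refine ⟨hx, hy, fun y' hy' => ?_, fun x' hx' => ?_⟩
  · refine (ciSup_le fun x' => dotProduct_le_of_mem_stdSimplex x'.2 hv).trans ?_
    refine le_trans ?_ (le_ciSup (bddAbove_payoff A y') ⟨x, hx⟩)
    rw [dotProduct_mulVec_eq]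
    exact le_dotProduct_of_mem_stdSimplex hy' hv'
  · refine le_trans ?_ (le_ciInf fun y' : stdSimplex ℝ (Fin m) => ?_ : v ≤ _)
    · exact (ciInf_le (bddBelow_payoff A x') ⟨y, hy⟩).trans
        (dotProduct_le_of_mem_stdSimplex hx' hv)
    · rw [dotProduct_mulVec_eq]
      exact le_dotProduct_of_mem_stdSimplex y'.2 hv'

/-- Minimax theorem: an optimal pair guarantees a common value to both players. -/
theorem IsOptimal.exists_value {x : Fin n → ℝ} {y : Fin m → ℝ} (h : IsOptimal A x y) :
    ∃ v, (∀ i, (A *ᵥ y) i ≤ v) ∧ ∀ j, v ≤ (Aᵀ *ᵥ x) j := by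
  have : Nonempty (stdSimplex ℝ (Fin n)) := ⟨⟨x, h.left_mem⟩⟩
  have : Nonempty (stdSimplex ℝ (Fin m)) := ⟨⟨y, h.right_mem⟩⟩
  have hlin1 : ∀ x : Fin n → ℝ, IsLinearMap ℝ fun y : Fin m → ℝ => x ⬝ᵥ (A *ᵥ y) := fun x =>
    ⟨fun a b => by rw [Matrix.mulVec_add, dotProduct_add],
      fun c a => by rw [Matrix.mulVec_smul, dotProduct_smul]⟩
  have hlin2 : ∀ y : Fin m → ℝ, IsLinearMap ℝ fun x : Fin n → ℝ => x ⬝ᵥ (A *ᵥ y) := fun y =>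
    ⟨fun a b => add_dotProduct _ _ _, fun c a => smul_dotProduct _ _ _⟩
  have hcont1 : ∀ x : Fin n → ℝ, Continuous fun y : Fin m → ℝ => x ⬝ᵥ (A *ᵥ y) := fun x =>
    (hlin1 x).mk'.continuous_of_finiteDimensional
  have hcont2 : ∀ y : Fin m → ℝ, Continuous fun x : Fin n → ℝ => x ⬝ᵥ (A *ᵥ y) := fun y =>
    (hlin2 y).mk'.continuous_of_finiteDimensional
  obtain ⟨y', hy', x', hx', hsad⟩ := Sion.exists_isSaddlePointOn
    (X := stdSimplex ℝ (Fin m)) (Y := stdSimplex ℝ (Fin n)) (f := fun y x => x ⬝ᵥ (A *ᵥ y))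
    ⟨y, h.right_mem⟩ (convex_stdSimplex ℝ _) (isCompact_stdSimplex ℝ _)
    (fun x _ => (hcont1 x).lowerSemicontinuous.lowerSemicontinuousOn _)
    (fun x _ => ((hlin1 x).mk'.convexOn (convex_stdSimplex ℝ _)).quasiconvexOn)
    (convex_stdSimplex ℝ _) ⟨x, h.left_mem⟩ (isCompact_stdSimplex ℝ _)
    (fun y _ => (hcont2 y).upperSemicontinuous.upperSemicontinuousOn _)
    (fun y _ => ((hlin2 y).mk'.concaveOn (convex_stdSimplex ℝ _)).quasiconcaveOn)
  refine ⟨x' ⬝ᵥ (A *ᵥ y'), fun i => ?_, fun j => ?_⟩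
  · have h1 : maxPayoff A y' ≤ x' ⬝ᵥ (A *ᵥ y') := ciSup_le fun z => hsad y' hy' z z.2
    have h2 := le_ciSup (bddAbove_payoff A y) ⟨Pi.single i 1, single_mem_stdSimplex ℝ i⟩
    exact (single_one_dotProduct i (A *ᵥ y)).ge.trans <| h2.trans ((h.minimax y' hy').trans h1)
  · have h1 : x' ⬝ᵥ (A *ᵥ y') ≤ minPayoff A x' := le_ciInf fun z => hsad z z.2 x' hx'
    have h2 := ciInf_le (bddBelow_payoff A x) ⟨Pi.single j 1, single_mem_stdSimplex ℝ j⟩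
    refine h1.trans ((h.maximin x' hx').trans (h2.trans ?_))
    rw [dotProduct_mulVec_eq]
    exact (single_one_dotProduct j (Aᵀ *ᵥ x)).le

/-- A row that no strategy guaranteeing `v` to the row player uses is strictly suboptimal
against some strategy of the column player. -/
theorem exists_strict_of_forall_eq_zero (A : Matrix (Fin n) (Fin m) ℝ) (v : ℝ) (i : Fin n)
    (h : ∀ x ∈ stdSimplex ℝ (Fin n), (∀ j, v ≤ (Aᵀ *ᵥ x) j) → x i = 0) :
    ∃ y ∈ stdSimplex ℝ (Fin m), (∀ k, (A *ᵥ y) k ≤ v) ∧ (A *ᵥ y) i < v := by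
  let a : Fin m ⊕ Fin n → (Fin n → ℝ) →ₗ[ℝ] ℝ := Sum.elim
    (fun j => ∑ k, (A k j - v) • LinearMap.proj k) (fun k => LinearMap.proj k)
  -- The guarantee of `v` is homogenized to a cone, on which `x i` vanishes. The multipliers of the
  -- column constraints, once normalized, form the required column strategy.
  obtain ⟨c, hc, hcb⟩ := farkas Finset.univ a (-LinearMap.proj i) (by
    intro x hx
    have hx0 : ∀ k, 0 ≤ x k := fun k => hx (Sum.inr k) (Finset.mem_univ _)
    have hxj : ∀ j, 0 ≤ ∑ k, (A k j - v) * x k := fun j => by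
      simpa [a] using hx (Sum.inl j) (Finset.mem_univ _)
    rw [LinearMap.neg_apply, LinearMap.proj_apply, neg_nonneg]
    by_contra hcon
    push Not at hcon
    have hS : 0 < ∑ k, x k :=
      lt_of_lt_of_le hcon (Finset.single_le_sum (fun k _ => hx0 k) (Finset.mem_univ i))
    have := h (fun k => (∑ k, x k)⁻¹ * x k)
      ⟨fun k => mul_nonneg (inv_nonneg.2 hS.le) (hx0 k), by
        rw [← Finset.mul_sum, inv_mul_cancel₀ hS.ne']⟩ (fun j => by
          have e : (Aᵀ *ᵥ fun k => (∑ k, x k)⁻¹ * x k) j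
              = v + (∑ k, x k)⁻¹ * ∑ k, (A k j - v) * x k := by
            simp only [Matrix.mulVec, dotProduct, Matrix.transpose_apply, sub_mul,
              Finset.sum_sub_distrib, ← Finset.mul_sum]
            rw [mul_sub, mul_left_comm, inv_mul_cancel₀ hS.ne', Finset.mul_sum]
            simp only [mul_left_comm]
            ring
          rw [e]
          have := mul_nonneg (inv_nonneg.2 hS.le) (hxj j)
          linarith)
    exact (mul_pos (inv_pos.2 hS) hcon).ne' this)
  have hrow : ∀ k, ∑ j, c (Sum.inl j) * (A k j - v) + c (Sum.inr k) = if k = i then -1 else 0 := by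
    intro k
    have := hcb (Pi.single k 1)
    simp only [Fintype.sum_sum_type, a, Sum.elim_inl, Sum.elim_inr, LinearMap.neg_apply,
      LinearMap.proj_apply, LinearMap.sum_apply, LinearMap.smul_apply, smul_eq_mul,
      Pi.single_apply, mul_ite, mul_one, mul_zero, Finset.sum_ite_eq',
      Finset.mem_univ, if_true] at this
    rw [← this]
    by_cases hki : i = k
    · subst hki; simp
    · rw [if_neg hki, if_neg (Ne.symm hki)]; simp
  have hcl : ∀ j, 0 ≤ c (Sum.inl j) := fun j => hc _ (Finset.mem_univ _)
  have hcr : ∀ k, 0 ≤ c (Sum.inr k) := fun k => hc _ (Finset.mem_univ _)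
  have hS0 : 0 ≤ ∑ j, c (Sum.inl j) := Finset.sum_nonneg fun j _ => hcl j
  -- If all column multipliers vanished, the row equation at `i` would make a nonnegative multiplier
  -- equal to -1.
  have hS : 0 < ∑ j, c (Sum.inl j) := by
    refine lt_of_le_of_ne hS0 fun h0 => ?_
    have hz := (Finset.sum_eq_zero_iff_of_nonneg fun j _ => hcl j).1 h0.symm
    have := hrow i
    rw [Finset.sum_eq_zero fun j hj => by rw [hz j hj, zero_mul], if_pos rfl] at this
    linarith [hcr i]
  have e : ∀ k, (A *ᵥ fun j => (∑ j, c (Sum.inl j))⁻¹ * c (Sum.inl j)) k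
      = v + (∑ j, c (Sum.inl j))⁻¹ * ∑ j, c (Sum.inl j) * (A k j - v) := by
    intro k
    simp only [Matrix.mulVec, dotProduct, mul_sub, Finset.sum_sub_distrib, ← Finset.sum_mul]
    rw [← mul_assoc, inv_mul_cancel₀ hS.ne', Finset.mul_sum]
    rw [Finset.sum_congr rfl fun j _ => show A k j * ((∑ j, c (Sum.inl j))⁻¹ * c (Sum.inl j))
      = (∑ j, c (Sum.inl j))⁻¹ * (c (Sum.inl j) * A k j) by ring]
    ring
  have hneg : ∀ k, ∑ j, c (Sum.inl j) * (A k j - v) ≤ if k = i then -1 else 0 := fun k => by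
    linarith [hrow k, hcr k]
  refine ⟨fun j => (∑ j, c (Sum.inl j))⁻¹ * c (Sum.inl j),
    ⟨fun j => mul_nonneg (inv_nonneg.2 hS0) (hcl j), by
      rw [← Finset.mul_sum, inv_mul_cancel₀ hS.ne']⟩, fun k => ?_, ?_⟩
  · rw [e]
    have h1 := hneg k
    have : (if k = i then (-1 : ℝ) else 0) ≤ 0 := by split_ifs <;> norm_num
    nlinarith [inv_pos.2 hS]
  · rw [e]
    have h1 := hneg i
    rw [if_pos rfl] at h1
    nlinarith [inv_pos.2 hS]

/-- If both optimal strategies are unique, then `ys` is the only strategy of the column player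
that equalizes the payoffs of the rows in the support of `xs`. -/
theorem eq_of_forall_support_eq_value {xs : Fin n → ℝ} {ys : Fin m → ℝ} {v : ℝ}
    (hys : ys ∈ stdSimplex ℝ (Fin m)) (hv : ∀ i, (A *ᵥ ys) i ≤ v)
    (hxu : ∀ x ∈ stdSimplex ℝ (Fin n), (∀ j, v ≤ (Aᵀ *ᵥ x) j) → x = xs)
    (hyu : ∀ y ∈ stdSimplex ℝ (Fin m), (∀ i, (A *ᵥ y) i ≤ v) → y = ys)
    {y : Fin m → ℝ} (hy : y ∈ stdSimplex ℝ (Fin m))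
    (h : ∀ i, xs i ≠ 0 → (A *ᵥ y) i = v) : y = ys := by
  have hmix : ∀ (ε : ℝ) i, (A *ᵥ ((1 - ε) • ys + ε • y)) i
      = (1 - ε) * (A *ᵥ ys) i + ε * (A *ᵥ y) i := fun ε i => by
    rw [Matrix.mulVec_add, Matrix.mulVec_smul, Matrix.mulVec_smul]
    rfl
  -- Rows outside the support of `xs` have strict slack at `ys` by strict complementarity, so a
  -- small move towards `y` keeps `ys` optimal; uniqueness then forces the move to be trivial.
  have hev : ∀ i, ∀ᶠ ε : ℝ in 𝓝[>] 0, (1 - ε) * (A *ᵥ ys) i + ε * (A *ᵥ y) i ≤ v := by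
    intro i
    by_cases hi : xs i = 0
    · obtain ⟨y', hy', hy'v, hy'i⟩ := exists_strict_of_forall_eq_zero A v i
        fun x hx hxv => by rw [hxu x hx hxv, hi]
      rw [hyu y' hy' hy'v] at hy'i
      have hc : Tendsto (fun ε : ℝ => (1 - ε) * (A *ᵥ ys) i + ε * (A *ᵥ y) i) (𝓝 0)
          (𝓝 ((1 - 0) * (A *ᵥ ys) i + 0 * (A *ᵥ y) i)) := Continuous.tendsto (by fun_prop) 0
      refine (hc.mono_left nhdsWithin_le_nhds).eventually_le_const ?_
      linarith
    · filter_upwards [Ioo_mem_nhdsGT (zero_lt_one' ℝ)] with ε hε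
      rw [h i hi]
      nlinarith [hv i, hε.2]
  obtain ⟨ε, hε, hε0, hε1⟩ :=
    ((eventually_all.2 hev).and (Ioo_mem_nhdsGT (zero_lt_one' ℝ))).exists
  have heq := hyu ((1 - ε) • ys + ε • y)
    (convex_stdSimplex ℝ _ hys hy (by linarith) hε0.le (by ring))
    (fun i => by rw [hmix]; exact hε i)
  funext j
  have hj : (1 - ε) * ys j + ε * y j = ys j := congrFun heq j
  exact mul_left_cancel₀ hε0.ne' (by linarith)

/-- A pair whose supports contain those of the unique optimal pair, and against which all rows
(columns) in its own support are indifferent, is the optimal pair. -/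
theorem eq_of_indifferent {xs : Fin n → ℝ} {ys : Fin m → ℝ} (hopt : IsOptimal A xs ys)
    (huniq : ∀ x y, IsOptimal A x y → x = xs ∧ y = ys)
    {x : Fin n → ℝ} {y : Fin m → ℝ} {a b : ℝ}
    (hx : x ∈ stdSimplex ℝ (Fin n)) (hy : y ∈ stdSimplex ℝ (Fin m))
    (hxs : ∀ i, xs i ≠ 0 → x i ≠ 0) (hys : ∀ j, ys j ≠ 0 → y j ≠ 0)
    (ha : ∀ i, x i ≠ 0 → (A *ᵥ y) i = a) (hb : ∀ j, y j ≠ 0 → (Aᵀ *ᵥ x) j = b) :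
    x = xs ∧ y = ys := by
  obtain ⟨v, hv, hv'⟩ := hopt.exists_value
  have hxu : ∀ x ∈ stdSimplex ℝ (Fin n), (∀ j, v ≤ (Aᵀ *ᵥ x) j) → x = xs :=
    fun x hx hxv => (huniq x ys (.of_value hx hopt.right_mem hv hxv)).1
  have hyu : ∀ y ∈ stdSimplex ℝ (Fin m), (∀ i, (A *ᵥ y) i ≤ v) → y = ys :=
    fun y hy hyv => (huniq xs y (.of_value hopt.left_mem hy hyv hv')).2
  have hconst : ∀ {k : ℕ} {p f : Fin k → ℝ} {c : ℝ}, p ∈ stdSimplex ℝ (Fin k) →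
      (∀ i, p i ≠ 0 → f i = c) → p ⬝ᵥ f = c := by
    intro k p f c hp hf
    calc p ⬝ᵥ f = ∑ i, p i * c := Finset.sum_congr rfl fun i _ => by
          by_cases hi : p i = 0
          · simp [hi]
          · rw [hf i hi]
      _ = c := by rw [← Finset.sum_mul, hp.2, one_mul]
  -- Both constants equal the payoff of `(x, y)`. Averaging them over `xs` and `ys`, whose supports
  -- are covered, squeezes them to `v`.
  have hab : a = b := by
    rw [← hconst hx ha, ← hconst hy hb, dotProduct_mulVec_eq]
  have hva : v ≤ a := by
    rw [← hconst hopt.left_mem fun i hi => ha i (hxs i hi), dotProduct_mulVec_eq]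
    exact le_dotProduct_of_mem_stdSimplex hy hv'
  have hbv : b ≤ v := by
    rw [← hconst hopt.right_mem fun j hj => hb j (hys j hj), ← dotProduct_mulVec_eq]
    exact dotProduct_le_of_mem_stdSimplex hx hv
  have hav : a = v := by linarith
  have hbv' : b = v := by linarith
  refine ⟨?_, eq_of_forall_support_eq_value hopt.right_mem hv hxu hyu hy
    fun i hi => hav ▸ ha i (hxs i hi)⟩
  -- The row player is the column player of the game `-Aᵀ`, of value `-v`.
  refine eq_of_forall_support_eq_value (A := -Aᵀ) (v := -v) (xs := ys) hopt.left_mem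
    (fun j => ?_) (fun y hy hyv => hyu y hy fun i => ?_) (fun x hx hxv => hxu x hx fun j => ?_) hx
    (fun j hj => ?_)
  · simpa [Matrix.neg_mulVec] using hv' j
  · simpa [Matrix.neg_mulVec] using hyv i
  · simpa [Matrix.neg_mulVec] using hxv j
  · simpa [Matrix.neg_mulVec, hbv'] using hb j (hys j hj)

end Game

/-! ### Entropic mirror steps -/

section Reweight

variable {k : ℕ} {p : Fin k → ℝ}

theorem sum_mul_exp_pos (hp : p ∈ simplexInterior k) (u : Fin k → ℝ) :
    0 < ∑ j, p j * Real.exp (u j) := by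
  have hk : (Finset.univ : Finset (Fin k)).Nonempty := by
    by_contra hcon
    have := hp.1.2
    rw [Finset.not_nonempty_iff_eq_empty.1 hcon, Finset.sum_empty] at this
    exact zero_ne_one this
  exact Finset.sum_pos (fun j _ => mul_pos (hp.2 j) (Real.exp_pos _)) hk

theorem reweight_mem_simplexInterior (hp : p ∈ simplexInterior k) (u : Fin k → ℝ) :
    reweight p u ∈ simplexInterior k := by
  have hS := sum_mul_exp_pos hp u
  have hpos : ∀ i, 0 < reweight p u i := fun i =>
    div_pos (mul_pos (hp.2 i) (Real.exp_pos _)) hS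
  refine ⟨⟨fun i => (hpos i).le, ?_⟩, hpos⟩
  simp only [reweight]
  rw [← Finset.sum_div, div_self hS.ne']

theorem reweight_reweight (hp : p ∈ simplexInterior k) (u w : Fin k → ℝ) :
    reweight (reweight p u) w = reweight p (fun i => u i + w i) := by
  have hS := sum_mul_exp_pos hp u
  funext i
  have h : ∀ j, p j * Real.exp (u j) / (∑ j, p j * Real.exp (u j)) * Real.exp (w j)
      = p j * Real.exp (u j + w j) / ∑ j, p j * Real.exp (u j) := fun j => by
    rw [Real.exp_add]; ring
  simp only [reweight, h]
  rw [← Finset.sum_div, div_div_div_cancel_right₀ hS.ne']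

theorem log_reweight (hp : p ∈ simplexInterior k) (u : Fin k → ℝ) (i : Fin k) :
    Real.log (reweight p u i)
      = Real.log (p i) + u i - Real.log (∑ j, p j * Real.exp (u j)) := by
  rw [reweight, Real.log_div (mul_pos (hp.2 i) (Real.exp_pos _)).ne' (sum_mul_exp_pos hp u).ne',
    Real.log_mul (hp.2 i).ne' (Real.exp_pos _).ne', Real.log_exp]

theorem le_one_of_mem_simplexInterior (hp : p ∈ simplexInterior k) (i : Fin k) : p i ≤ 1 := by
  rw [← hp.1.2]
  exact Finset.single_le_sum (fun j _ => hp.1.1 j) (Finset.mem_univ i)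

/-- Applying `log s ≤ s - 1` to `√b / √a` bounds the right side below by `(√a - √b) ^ 2`; the
remaining factor `(√a + √b) ^ 2` of `(a - b) ^ 2` is at most 4. -/
theorem sq_sub_le_mul_log {a b : ℝ} (ha : 0 < a) (hb : 0 < b) (ha1 : a ≤ 1) (hb1 : b ≤ 1) :
    (a - b) ^ 2 / 4 ≤ a * (Real.log a - Real.log b) - a + b := by
  have hs : 0 < √a := Real.sqrt_pos.2 ha
  have ht : 0 < √b := Real.sqrt_pos.2 hb
  have hs1 : √a ≤ 1 := Real.sqrt_le_one.2 ha1
  have ht1 : √b ≤ 1 := Real.sqrt_le_one.2 hb1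
  have hsa : √a ^ 2 = a := Real.sq_sqrt ha.le
  have htb : √b ^ 2 = b := Real.sq_sqrt hb.le
  have hlog : Real.log b - Real.log a = 2 * Real.log (√b / √a) := by
    rw [Real.log_div ht.ne' hs.ne', Real.log_sqrt ha.le, Real.log_sqrt hb.le]
    ring
  have hle : Real.log (√b / √a) ≤ √b / √a - 1 := Real.log_le_sub_one_of_pos (div_pos ht hs)
  have h1 : a * (Real.log a - Real.log b) ≥ 2 * √a ^ 2 - 2 * (√a * √b) := by
    have h2 : a * (√b / √a) = √a * √b := by
      nth_rewrite 1 [← hsa]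
      field_simp
    rw [hsa, ← neg_sub (Real.log b), hlog]
    nlinarith
  have h3 : (a - b) ^ 2 = (√a - √b) ^ 2 * (√a + √b) ^ 2 := by
    rw [← mul_pow, ← hsa, ← htb, Real.sqrt_sq hs.le, Real.sqrt_sq ht.le]
    ring
  have h4 : (√a + √b) ^ 2 ≤ 4 := by nlinarith
  have h5 : (√a - √b) ^ 2 * (√a + √b) ^ 2 ≤ (√a - √b) ^ 2 * 4 :=
    mul_le_mul_of_nonneg_left h4 (sq_nonneg _)
  nlinarith

/-- A Pinsker-type bound of the squared Euclidean distance by the relative entropy. -/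
theorem sum_sq_sub_le_sum_mul_log {q : Fin k → ℝ} (hp : p ∈ simplexInterior k)
    (hq : q ∈ simplexInterior k) :
    (∑ i, (p i - q i) ^ 2) / 4 ≤ ∑ i, p i * (Real.log (p i) - Real.log (q i)) := by
  have h := Finset.sum_le_sum fun i (_ : i ∈ (Finset.univ : Finset (Fin k))) =>
    sq_sub_le_mul_log (hp.2 i) (hq.2 i) (le_one_of_mem_simplexInterior hp i)
      (le_one_of_mem_simplexInterior hq i)
  rw [Finset.sum_add_distrib, Finset.sum_sub_distrib, hp.1.2, hq.1.2, ← Finset.sum_div] at h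
  linarith

/-- The one-step inequality of optimistic mirror ascent with entropic regularizer. -/
theorem cross_entropy_reweight_le {r : Fin k → ℝ} (hp : p ∈ simplexInterior k)
    (hr : r ∈ stdSimplex ℝ (Fin k)) (g g' : Fin k → ℝ) :
    -∑ i, r i * Real.log (reweight p g i) ≤ -∑ i, r i * Real.log (p i)
      - (r - reweight p g') ⬝ᵥ g + (reweight p g - reweight p g') ⬝ᵥ (g - g')
      - (∑ i, (reweight p g i - reweight p g' i) ^ 2) / 4
      - (∑ i, (reweight p g' i - p i) ^ 2) / 4 := by
  have hq := reweight_mem_simplexInterior hp g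
  have hq' := reweight_mem_simplexInterior hp g'
  have h1 := sum_sq_sub_le_sum_mul_log hq hq'
  have h2 := sum_sq_sub_le_sum_mul_log hq' hp
  have hsum := hq.1.2
  have hsum' := hq'.1.2
  have hlog := log_reweight hp g
  have hlog' := log_reweight hp g'
  set q := reweight p g
  set q' := reweight p g'
  set L := Real.log (∑ j, p j * Real.exp (g j))
  set L' := Real.log (∑ j, p j * Real.exp (g' j))
  -- The log-normalizers `L` and `L'` cancel when this is combined with the two relative entropies
  -- below, leaving an exact identity to which the Pinsker-type bounds apply.
  have e0 : ∑ i, r i * Real.log (q i) = ∑ i, r i * Real.log (p i) + r ⬝ᵥ g - L := by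
    simp only [hlog, mul_sub, mul_add, Finset.sum_sub_distrib, Finset.sum_add_distrib,
      ← Finset.sum_mul, hr.2, one_mul, dotProduct]
  have e1 : ∑ i, q i * (Real.log (q i) - Real.log (q' i)) = q ⬝ᵥ (g - g') - L + L' := by
    have : ∀ i, q i * (Real.log (q i) - Real.log (q' i))
        = q i * (g - g') i - q i * L + q i * L' := fun i => by
      rw [hlog, hlog', Pi.sub_apply]; ring
    simp only [this, Finset.sum_sub_distrib, Finset.sum_add_distrib,
      ← Finset.sum_mul, hsum, one_mul, dotProduct]
  have e2 : ∑ i, q' i * (Real.log (q' i) - Real.log (p i)) = q' ⬝ᵥ g' - L' := by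
    have : ∀ i, q' i * (Real.log (q' i) - Real.log (p i))
        = q' i * g' i - q' i * L' := fun i => by
      rw [hlog']; ring
    simp only [this, Finset.sum_sub_distrib, ← Finset.sum_mul, hsum', one_mul, dotProduct]
  rw [e1] at h1
  rw [e2] at h2
  rw [e0]
  simp only [sub_dotProduct, dotProduct_sub] at h1 ⊢
  linarith

end Reweight

/-! ### Bilinear and quadratic estimates -/

section Bilinear

variable {n m : ℕ}

theorem dotProduct_mulVec_le (A : Matrix (Fin n) (Fin m) ℝ) (u : Fin n → ℝ) (w : Fin m → ℝ) :
    u ⬝ᵥ (A *ᵥ w) ≤ (∑ i, ∑ j, |A i j|) * (∑ i, u i ^ 2 + ∑ j, w j ^ 2) := by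
  simp only [dotProduct, Matrix.mulVec, Finset.mul_sum _ _ (u _)]
  rw [Finset.sum_mul]
  refine Finset.sum_le_sum fun i _ => ?_
  rw [Finset.sum_mul]
  refine Finset.sum_le_sum fun j _ => ?_
  have hu : u i ^ 2 ≤ ∑ i, u i ^ 2 :=
    Finset.single_le_sum (f := fun i => u i ^ 2) (fun _ _ => sq_nonneg _) (Finset.mem_univ i)
  have hw : w j ^ 2 ≤ ∑ j, w j ^ 2 :=
    Finset.single_le_sum (f := fun j => w j ^ 2) (fun _ _ => sq_nonneg _) (Finset.mem_univ j)
  calc u i * (A i j * w j) ≤ |u i * (A i j * w j)| := le_abs_self _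
    _ = |A i j| * (|u i| * |w j|) := by rw [abs_mul, abs_mul]; ring
    _ ≤ |A i j| * (∑ i, u i ^ 2 + ∑ j, w j ^ 2) := by
      refine mul_le_mul_of_nonneg_left ?_ (abs_nonneg _)
      nlinarith [sq_abs (u i), sq_abs (w j), sq_nonneg (|u i| - |w j|), sq_nonneg (u i),
        sq_nonneg (w j)]

theorem sum_sq_sub_le {k : ℕ} (p q r : Fin k → ℝ) :
    ∑ i, (p - r) i ^ 2 ≤ 2 * ∑ i, (p i - q i) ^ 2 + 2 * ∑ i, (q i - r i) ^ 2 := by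
  rw [Finset.mul_sum, Finset.mul_sum, ← Finset.sum_add_distrib]
  refine Finset.sum_le_sum fun i _ => ?_
  rw [Pi.sub_apply]
  nlinarith [sq_nonneg ((p i - q i) - (q i - r i))]

end Bilinear

/-! ### Two-sequence dynamics and the decreasing potential -/

/-- The two-sequence form of the OMWU dynamics: `X (t + 1)` and `Xh (t + 1)` are obtained from
the secondary iterate `Xh t` by reweighting with the payoffs against `Y t` and `Y (t + 1)`. -/
structure IsTwoSequence {n m : ℕ} (A : Matrix (Fin n) (Fin m) ℝ) (η : ℝ)
    (X Xh : ℕ → Fin n → ℝ) (Y Yh : ℕ → Fin m → ℝ) : Prop where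
  left_mem : ∀ t, X t ∈ simplexInterior n
  left_hat_mem : ∀ t, Xh t ∈ simplexInterior n
  right_mem : ∀ t, Y t ∈ simplexInterior m
  right_hat_mem : ∀ t, Yh t ∈ simplexInterior m
  left : ∀ t, X (t + 1) = reweight (Xh t) (η • (A *ᵥ Y t))
  left_hat : ∀ t, Xh (t + 1) = reweight (Xh t) (η • (A *ᵥ Y (t + 1)))
  right : ∀ t, Y (t + 1) = reweight (Yh t) (-(η • (Aᵀ *ᵥ X t)))
  right_hat : ∀ t, Yh (t + 1) = reweight (Yh t) (-(η • (Aᵀ *ᵥ X (t + 1))))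

namespace IsTwoSequence

variable {n m : ℕ} {A : Matrix (Fin n) (Fin m) ℝ} {η : ℝ}
  {X Xh : ℕ → Fin n → ℝ} {Y Yh : ℕ → Fin m → ℝ}

/-- Adding the mirror inequalities of both players leaves the regret against the optimal pair, which
has a favourable sign, and prediction errors, which the negative quadratic terms absorb for small η.
The `/ 8` term in the potential pays for the errors involving the gap at time `t`. -/
theorem potential_step (h : IsTwoSequence A η X Xh Y Yh) (hη : 0 ≤ η)
    (hηA : η * (∑ i, ∑ j, |A i j|) ≤ 1 / 64)
    {xs : Fin n → ℝ} {ys : Fin m → ℝ} (hxs : xs ∈ stdSimplex ℝ (Fin n))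
    (hys : ys ∈ stdSimplex ℝ (Fin m)) {v : ℝ} (hv : ∀ i, (A *ᵥ ys) i ≤ v)
    (hv' : ∀ j, v ≤ (Aᵀ *ᵥ xs) j) (t : ℕ) :
    (-∑ i, xs i * Real.log (Xh (t + 1) i) - ∑ j, ys j * Real.log (Yh (t + 1) j))
      + (∑ i, (Xh (t + 1) i - X (t + 1) i) ^ 2 + ∑ j, (Yh (t + 1) j - Y (t + 1) j) ^ 2) / 8
      + (∑ i, (Xh t i - X t i) ^ 2 + ∑ j, (Yh t j - Y t j) ^ 2) / 16
      + (∑ i, (X (t + 1) i - Xh t i) ^ 2 + ∑ j, (Y (t + 1) j - Yh t j) ^ 2) / 16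
    ≤ (-∑ i, xs i * Real.log (Xh t i) - ∑ j, ys j * Real.log (Yh t j))
      + (∑ i, (Xh t i - X t i) ^ 2 + ∑ j, (Yh t j - Y t j) ^ 2) / 8 := by
  have h1 := cross_entropy_reweight_le (h.left_hat_mem t) hxs
    (η • (A *ᵥ Y (t + 1))) (η • (A *ᵥ Y t))
  have h2 := cross_entropy_reweight_le (h.right_hat_mem t) hys
    (-(η • (Aᵀ *ᵥ X (t + 1)))) (-(η • (Aᵀ *ᵥ X t)))
  rw [← h.left, ← h.left_hat] at h1
  rw [← h.right, ← h.right_hat] at h2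
  -- The terms pairing `X (t + 1)` with `Y (t + 1)` cancel because the game is zero-sum.
  have hgap : 0 ≤ (xs - X (t + 1)) ⬝ᵥ (η • (A *ᵥ Y (t + 1)))
      + (ys - Y (t + 1)) ⬝ᵥ (-(η • (Aᵀ *ᵥ X (t + 1)))) := by
    have e1 : v ≤ xs ⬝ᵥ (A *ᵥ Y (t + 1)) := by
      rw [dotProduct_mulVec_eq]
      exact le_dotProduct_of_mem_stdSimplex (h.right_mem _).1 hv'
    have e2 : X (t + 1) ⬝ᵥ (A *ᵥ ys) ≤ v :=
      dotProduct_le_of_mem_stdSimplex (h.left_mem _).1 hv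
    simp only [sub_dotProduct, dotProduct_smul, dotProduct_neg, ← dotProduct_mulVec_eq,
      smul_eq_mul]
    nlinarith
  have hc1 : (Xh (t + 1) - X (t + 1)) ⬝ᵥ (η • (A *ᵥ Y (t + 1)) - η • (A *ᵥ Y t))
      ≤ 1 / 64 * (∑ i, (Xh (t + 1) - X (t + 1)) i ^ 2 + ∑ j, (Y (t + 1) - Y t) j ^ 2) := by
    rw [← smul_sub, ← Matrix.mulVec_sub, dotProduct_smul, smul_eq_mul]
    refine (mul_le_mul_of_nonneg_left (dotProduct_mulVec_le A _ _) hη).trans ?_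
    rw [← mul_assoc]
    exact mul_le_mul_of_nonneg_right hηA (by positivity)
  have hc2 : (Yh (t + 1) - Y (t + 1)) ⬝ᵥ (-(η • (Aᵀ *ᵥ X (t + 1))) - -(η • (Aᵀ *ᵥ X t)))
      ≤ 1 / 64 * (∑ i, (X t - X (t + 1)) i ^ 2 + ∑ j, (Yh (t + 1) - Y (t + 1)) j ^ 2) := by
    rw [← neg_sub', ← smul_sub, ← smul_neg, ← Matrix.mulVec_sub, ← Matrix.mulVec_neg, neg_sub,
      dotProduct_smul, smul_eq_mul, ← dotProduct_mulVec_eq]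
    refine (mul_le_mul_of_nonneg_left (dotProduct_mulVec_le A _ _) hη).trans ?_
    rw [← mul_assoc]
    exact mul_le_mul_of_nonneg_right hηA (by positivity)
  -- Passing through the secondary iterate expresses the prediction error by the gaps occurring in
  -- the potential inequality.
  have hd1 := sum_sq_sub_le (Y (t + 1)) (Yh t) (Y t)
  have hd2 := sum_sq_sub_le (X (t + 1)) (Xh t) (X t)
  have hd3 : ∑ i, (X t - X (t + 1)) i ^ 2 = ∑ i, (X (t + 1) - X t) i ^ 2 :=
    Finset.sum_congr rfl fun i _ => by simp only [Pi.sub_apply]; ring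
  rw [hd3] at hc2
  simp only [Pi.sub_apply] at hc1 hc2 hd1 hd2
  have p1 : 0 ≤ ∑ i, (Xh (t + 1) i - X (t + 1) i) ^ 2 := by positivity
  have p2 : 0 ≤ ∑ j, (Yh (t + 1) j - Y (t + 1) j) ^ 2 := by positivity
  have p3 : 0 ≤ ∑ i, (X (t + 1) i - Xh t i) ^ 2 := by positivity
  have p4 : 0 ≤ ∑ j, (Y (t + 1) j - Yh t j) ^ 2 := by positivity
  have p5 : 0 ≤ ∑ i, (Xh t i - X t i) ^ 2 := by positivity
  have p6 : 0 ≤ ∑ j, (Yh t j - Y t j) ^ 2 := by positivity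
  linarith

end IsTwoSequence

theorem tendsto_zero_of_add_le {Ψ D : ℕ → ℝ} (hΨ : ∀ t, 0 ≤ Ψ t) (hD : ∀ t, 0 ≤ D t)
    (h : ∀ t, Ψ (t + 1) + D t ≤ Ψ t) : Tendsto D atTop (𝓝 0) := by
  have hanti : Antitone Ψ := antitone_nat_of_succ_le fun t => by linarith [h t, hD t]
  have hlim := tendsto_atTop_ciInf hanti ⟨0, by rintro _ ⟨t, rfl⟩; exact hΨ t⟩
  have hdiff := hlim.sub (hlim.comp (tendsto_add_atTop_nat 1))
  rw [sub_self] at hdiff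
  exact squeeze_zero hD (fun t => by simp only [Function.comp_apply]; linarith [h t]) hdiff

theorem tendsto_zero_of_sum_sq_le {k : ℕ} {u : ℕ → Fin k → ℝ} {D : ℕ → ℝ}
    (h : ∀ t, ∑ i, u t i ^ 2 ≤ D t) (hD : Tendsto D atTop (𝓝 0)) : Tendsto u atTop (𝓝 0) := by
  rw [tendsto_pi_nhds]
  intro i
  have hle : ∀ t, u t i ^ 2 ≤ D t := fun t => (Finset.single_le_sum (f := fun i => u t i ^ 2)
    (fun _ _ => sq_nonneg _) (Finset.mem_univ i)).trans (h t)
  have hsq := (squeeze_zero (fun t => sq_nonneg _) hle hD).sqrt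
  simp only [Real.sqrt_sq_eq_abs, Real.sqrt_zero] at hsq
  exact (tendsto_zero_iff_abs_tendsto_zero _).2 hsq

/-! ### Cross entropy bounds and limits of reweightings -/

section CrossEntropy

variable {k : ℕ} {p r : Fin k → ℝ}

theorem cross_entropy_nonneg (hp : p ∈ simplexInterior k) (hr : r ∈ stdSimplex ℝ (Fin k)) :
    0 ≤ -∑ i, r i * Real.log (p i) := by
  rw [← Finset.sum_neg_distrib]
  refine Finset.sum_nonneg fun i _ => ?_
  have := Real.log_nonpos (hp.2 i).le (le_one_of_mem_simplexInterior hp i)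
  nlinarith [hr.1 i]

/-- Every summand is nonnegative, so `C` bounds each one. This keeps iterates away from the faces
that miss part of the optimal support. -/
theorem exp_neg_div_le_of_cross_entropy_le (hp : p ∈ simplexInterior k)
    (hr : r ∈ stdSimplex ℝ (Fin k)) {C : ℝ} (hC : -∑ i, r i * Real.log (p i) ≤ C) {i : Fin k}
    (hi : r i ≠ 0) : Real.exp (-(C / r i)) ≤ p i := by
  have hri : 0 < r i := lt_of_le_of_ne (hr.1 i) hi.symm
  have hle : -(r i * Real.log (p i)) ≤ C := by
    refine le_trans ?_ hC
    rw [← Finset.sum_neg_distrib]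
    refine Finset.single_le_sum (f := fun i => -(r i * Real.log (p i))) (fun j _ => ?_)
      (Finset.mem_univ i)
    have := Real.log_nonpos (hp.2 j).le (le_one_of_mem_simplexInterior hp j)
    nlinarith [hr.1 j]
  rw [← Real.le_log_iff_exp_le (hp.2 i), ← neg_div, div_le_iff₀ hri]
  linarith

/-- A common limit of weights before and after reweighting is indifferent on its support. -/
theorem eq_log_of_tendsto_reweight {l : Filter ℕ} [l.NeBot] {P g : ℕ → Fin k → ℝ}
    {u : Fin k → ℝ} (hP : ∀ t, P t ∈ simplexInterior k) (hPp : Tendsto P l (𝓝 p))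
    (hQp : Tendsto (fun t => reweight (P t) (g t)) l (𝓝 p)) (hg : Tendsto g l (𝓝 u))
    {i : Fin k} (hi : p i ≠ 0) : u i = Real.log (∑ j, p j * Real.exp (u j)) := by
  have hterm : ∀ j, Tendsto (fun t => P t j * Real.exp (g t j)) l (𝓝 (p j * Real.exp (u j))) :=
    fun j => (tendsto_pi_nhds.1 hPp j).mul
      ((Real.continuous_exp.tendsto _).comp (tendsto_pi_nhds.1 hg j))
  have hZ : Tendsto (fun t => ∑ j, P t j * Real.exp (g t j)) l
      (𝓝 (∑ j, p j * Real.exp (u j))) := tendsto_finsetSum _ fun j _ => hterm j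
  have heq : ∀ t, reweight (P t) (g t) i * ∑ j, P t j * Real.exp (g t j)
      = P t i * Real.exp (g t i) := fun t =>
    div_mul_cancel₀ _ (sum_mul_exp_pos (hP t) (g t)).ne'
  have hlim := (tendsto_pi_nhds.1 hQp i).mul hZ
  simp only [heq] at hlim
  rw [← mul_left_cancel₀ hi (tendsto_nhds_unique (hterm i) hlim), Real.log_exp]

end CrossEntropy

/-! ### Convergence of the two-sequence dynamics -/

namespace IsTwoSequence

variable {n m : ℕ} {A : Matrix (Fin n) (Fin m) ℝ} {η : ℝ}
  {X Xh : ℕ → Fin n → ℝ} {Y Yh : ℕ → Fin m → ℝ}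

theorem tendsto (h : IsTwoSequence A η X Xh Y Yh) (hη : 0 < η)
    (hηA : η * (∑ i, ∑ j, |A i j|) ≤ 1 / 64)
    {xs : Fin n → ℝ} {ys : Fin m → ℝ} (hopt : IsOptimal A xs ys)
    (huniq : ∀ x y, IsOptimal A x y → x = xs ∧ y = ys) :
    Tendsto (fun t => (X t, Y t)) atTop (𝓝 (xs, ys)) := by
  obtain ⟨v, hv, hv'⟩ := hopt.exists_value
  set Φx : ℕ → ℝ := fun t => -∑ i, xs i * Real.log (Xh t i) with hΦx
  set Φy : ℕ → ℝ := fun t => -∑ j, ys j * Real.log (Yh t j) with hΦy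
  set a : ℕ → ℝ := fun t => ∑ i, (Xh t i - X t i) ^ 2 + ∑ j, (Yh t j - Y t j) ^ 2 with ha
  set b : ℕ → ℝ := fun t => ∑ i, (X (t + 1) i - Xh t i) ^ 2 + ∑ j, (Y (t + 1) j - Yh t j) ^ 2
    with hb
  have hΦx0 : ∀ t, 0 ≤ Φx t := fun t => cross_entropy_nonneg (h.left_hat_mem t) hopt.left_mem
  have hΦy0 : ∀ t, 0 ≤ Φy t := fun t => cross_entropy_nonneg (h.right_hat_mem t) hopt.right_mem
  have ha0 : ∀ t, 0 ≤ a t := fun t => by simp only [ha]; positivity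
  have hb0 : ∀ t, 0 ≤ b t := fun t => by simp only [hb]; positivity
  have hstep : ∀ t, (Φx (t + 1) + Φy (t + 1) + a (t + 1) / 8) + (a t / 16 + b t / 16)
      ≤ Φx t + Φy t + a t / 8 := fun t => by
    have := h.potential_step hη.le hηA hopt.left_mem hopt.right_mem hv hv' t
    simp only [hΦx, hΦy, ha, hb]
    linarith
  have hD := tendsto_zero_of_add_le (Ψ := fun t => Φx t + Φy t + a t / 8)
    (D := fun t => a t / 16 + b t / 16) (fun t => by linarith [hΦx0 t, hΦy0 t, ha0 t])
    (fun t => by linarith [ha0 t, hb0 t]) hstep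
  have hanti : Antitone fun t => Φx t + Φy t + a t / 8 :=
    antitone_nat_of_succ_le fun t => by linarith [hstep t, ha0 t, hb0 t]
  obtain ⟨C, hC⟩ : ∃ C, ∀ t, Φx t + Φy t + a t / 8 ≤ C := ⟨_, fun t => hanti (Nat.zero_le t)⟩
  have hCx : ∀ t, Φx t ≤ C := fun t => by linarith [hC t, hΦy0 t, ha0 t]
  have hCy : ∀ t, Φy t ≤ C := fun t => by linarith [hC t, hΦx0 t, ha0 t]
  -- Rescaling turns the decrement into `a t + b t`, which dominates each squared gap.
  have hD16 := hD.const_mul 16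
  rw [mul_zero] at hD16
  have hXh : Tendsto (fun t => Xh t - X t) atTop (𝓝 0) :=
    tendsto_zero_of_sum_sq_le (fun t => by
      have h1 : 0 ≤ ∑ j, (Yh t j - Y t j) ^ 2 := by positivity
      have h2 := hb0 t
      simp only [Pi.sub_apply, ha]
      linarith) hD16
  have hYh : Tendsto (fun t => Yh t - Y t) atTop (𝓝 0) :=
    tendsto_zero_of_sum_sq_le (fun t => by
      have h1 : 0 ≤ ∑ i, (Xh t i - X t i) ^ 2 := by positivity
      have h2 := hb0 t
      simp only [Pi.sub_apply, ha]
      linarith) hD16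
  have hXs : Tendsto (fun t => X (t + 1) - Xh t) atTop (𝓝 0) :=
    tendsto_zero_of_sum_sq_le (fun t => by
      have h1 : 0 ≤ ∑ j, (Y (t + 1) j - Yh t j) ^ 2 := by positivity
      have h2 := ha0 t
      simp only [Pi.sub_apply, hb]
      linarith) hD16
  have hYs : Tendsto (fun t => Y (t + 1) - Yh t) atTop (𝓝 0) :=
    tendsto_zero_of_sum_sq_le (fun t => by
      have h1 : 0 ≤ ∑ i, (X (t + 1) i - Xh t i) ^ 2 := by positivity
      have h2 := ha0 t
      simp only [Pi.sub_apply, hb]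
      linarith) hD16
  refine ((isCompact_stdSimplex ℝ (Fin n)).prod
    (isCompact_stdSimplex ℝ (Fin m))).tendsto_nhds_of_unique_mapClusterPt
    (Eventually.of_forall fun t => ⟨(h.left_mem t).1, (h.right_mem t).1⟩) ?_
  rintro ⟨x, y⟩ ⟨hx, hy⟩ hcl
  -- Along an ultrafilter the vanishing gaps carry the limit of `(X, Y)` over to `Xh`, `Yh` and all
  -- their shifts by one.
  obtain ⟨U, hU, hUlim⟩ := mapClusterPt_iff_ultrafilter.1 hcl
  have lX : Tendsto X U (𝓝 x) := (continuous_fst.tendsto _).comp hUlim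
  have lY : Tendsto Y U (𝓝 y) := (continuous_snd.tendsto _).comp hUlim
  have lXh : Tendsto Xh U (𝓝 x) := by simpa using (hXh.mono_left hU).add lX
  have lYh : Tendsto Yh U (𝓝 y) := by simpa using (hYh.mono_left hU).add lY
  have lXs : Tendsto (fun t => X (t + 1)) U (𝓝 x) := by simpa using (hXs.mono_left hU).add lXh
  have lYs : Tendsto (fun t => Y (t + 1)) U (𝓝 y) := by simpa using (hYs.mono_left hU).add lYh
  have lXhs : Tendsto (fun t => Xh (t + 1)) U (𝓝 x) := by
    simpa using ((hXh.comp (tendsto_add_atTop_nat 1)).mono_left hU).add lXs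
  have lYhs : Tendsto (fun t => Yh (t + 1)) U (𝓝 y) := by
    simpa using ((hYh.comp (tendsto_add_atTop_nat 1)).mono_left hU).add lYs
  have lg : Tendsto (fun t => η • (A *ᵥ Y (t + 1))) U (𝓝 (η • (A *ᵥ y))) :=
    (Continuous.tendsto (f := fun y => η • (A *ᵥ y)) (by fun_prop) y).comp lYs
  have lg' : Tendsto (fun t => -(η • (Aᵀ *ᵥ X (t + 1)))) U (𝓝 (-(η • (Aᵀ *ᵥ x)))) :=
    (Continuous.tendsto (f := fun x => -(η • (Aᵀ *ᵥ x))) (by fun_prop) x).comp lXs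
  simp only [h.left_hat] at lXhs
  simp only [h.right_hat] at lYhs
  have hfix := @eq_log_of_tendsto_reweight _ _ _ _ _ _ _ h.left_hat_mem lXh lXhs lg
  have hfix' := @eq_log_of_tendsto_reweight _ _ _ _ _ _ _ h.right_hat_mem lYh lYhs lg'
  simp only [Pi.smul_apply, Pi.neg_apply, smul_eq_mul] at hfix hfix'
  obtain ⟨rfl, rfl⟩ := eq_of_indifferent hopt huniq hx hy
    (fun i hi => ((Real.exp_pos _).trans_le (ge_of_tendsto (tendsto_pi_nhds.1 lXh i)
      (Eventually.of_forall fun t => exp_neg_div_le_of_cross_entropy_le (h.left_hat_mem t)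
        hopt.left_mem (hCx t) hi))).ne')
    (fun j hj => ((Real.exp_pos _).trans_le (ge_of_tendsto (tendsto_pi_nhds.1 lYh j)
      (Eventually.of_forall fun t => exp_neg_div_le_of_cross_entropy_le (h.right_hat_mem t)
        hopt.right_mem (hCy t) hj))).ne')
    (fun i hi => (eq_div_iff hη.ne').2 ((mul_comm _ _).trans (hfix hi)))
    (fun j hj => (eq_div_iff hη.ne').2 ((mul_comm _ _).trans (neg_eq_iff_eq_neg.1 (hfix' hj))))
  rfl

end IsTwoSequence

/-! ### From OMWU to the two-sequence form -/

section Iterate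

variable {n m : ℕ} (A : Matrix (Fin n) (Fin m) ℝ) (η : ℝ) {z0 z1 : (Fin n → ℝ) × (Fin m → ℝ)}

theorem iterate_mem_simplexInterior
    (h0 : z0.1 ∈ simplexInterior n ∧ z0.2 ∈ simplexInterior m)
    (h1 : z1.1 ∈ simplexInterior n ∧ z1.2 ∈ simplexInterior m) :
    ∀ t, (iterate A η z0 z1 t).1 ∈ simplexInterior n ∧
      (iterate A η z0 z1 t).2 ∈ simplexInterior m
  | 0 => h0
  | 1 => h1
  | t + 2 => by
    have ih := iterate_mem_simplexInterior h0 h1 (t + 1)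
    exact ⟨reweight_mem_simplexInterior ih.1 _, reweight_mem_simplexInterior ih.2 _⟩

theorem reweight_zero {k : ℕ} {p : Fin k → ℝ} (hp : p ∈ simplexInterior k) :
    reweight p (fun _ => 0) = p := by
  funext i
  simp [reweight, hp.1.2]

/-- Reweightings compose by adding exponents, so removing one payoff from the optimistic exponent
leaves a plain mirror step. The secondary iterate at `t` is built from the iterate at `t + 1`, so
the relations hold from `t = 0` for arbitrary independent starting points. -/
theorem isTwoSequence_iterate
    (h0 : z0.1 ∈ simplexInterior n ∧ z0.2 ∈ simplexInterior m)
    (h1 : z1.1 ∈ simplexInterior n ∧ z1.2 ∈ simplexInterior m) :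
    IsTwoSequence A η (fun t => (iterate A η z0 z1 t).1)
      (fun t => reweight (iterate A η z0 z1 (t + 1)).1 (-(η • (A *ᵥ (iterate A η z0 z1 t).2))))
      (fun t => (iterate A η z0 z1 t).2)
      (fun t => reweight (iterate A η z0 z1 (t + 1)).2 (η • (Aᵀ *ᵥ (iterate A η z0 z1 t).1))) := by
  have hmem := iterate_mem_simplexInterior A η h0 h1
  refine ⟨fun t => (hmem t).1, fun t => reweight_mem_simplexInterior (hmem _).1 _,
    fun t => (hmem t).2, fun t => reweight_mem_simplexInterior (hmem _).2 _,
    fun t => ?_, fun t => ?_, fun t => ?_, fun t => ?_⟩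
  · rw [reweight_reweight (hmem _).1]
    simp [reweight_zero (hmem _).1]
  · rw [reweight_reweight (hmem _).1]
    simp only [iterate, step]
    rw [reweight_reweight (hmem _).1]
    congr 1
    funext i
    simp only [Pi.neg_apply, Pi.smul_apply, smul_eq_mul]
    ring
  · rw [reweight_reweight (hmem _).2]
    simp [reweight_zero (hmem _).2]
  · rw [reweight_reweight (hmem _).2]
    simp only [iterate, step]
    rw [reweight_reweight (hmem _).2]
    congr 1
    funext i
    simp only [Pi.neg_apply, Pi.smul_apply, smul_eq_mul]
    ring

/-- Last-iterate convergence of OMWU from arbitrary interior starting points, for all stepsizes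
below a threshold that depends on the payoff matrix only. -/
theorem exists_stepsize_forall_tendsto_iterate {xs : Fin n → ℝ} {ys : Fin m → ℝ}
    (hopt : IsOptimal A xs ys) (huniq : ∀ x y, IsOptimal A x y → x = xs ∧ y = ys) :
    ∃ η₀ : ℝ, 0 < η₀ ∧ ∀ η : ℝ, 0 < η → η < η₀ → ∀ z0 z1 : (Fin n → ℝ) × (Fin m → ℝ),
      (z0.1 ∈ simplexInterior n ∧ z0.2 ∈ simplexInterior m) →
      (z1.1 ∈ simplexInterior n ∧ z1.2 ∈ simplexInterior m) →
      Tendsto (iterate A η z0 z1) atTop (𝓝 (xs, ys)) := by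
  have hM : 0 ≤ ∑ i, ∑ j, |A i j| := by positivity
  -- The added 1 keeps the threshold finite and positive when `A = 0`.
  refine ⟨1 / (64 * (∑ i, ∑ j, |A i j| + 1)), by positivity, fun η hη hη0 z0 z1 h0 h1 => ?_⟩
  refine (isTwoSequence_iterate A η h0 h1).tendsto hη ?_ hopt huniq
  rw [lt_div_iff₀ (by positivity)] at hη0
  linarith

theorem uniform_mem_simplexInterior {k : ℕ} (hk : k ≠ 0) : uniform k ∈ simplexInterior k := by
  have hk' : (0 : ℝ) < k := Nat.cast_pos.2 (Nat.pos_of_ne_zero hk)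
  have hpos : ∀ i, 0 < uniform k i := fun i => by unfold uniform; positivity
  refine ⟨⟨fun i => (hpos i).le, ?_⟩, hpos⟩
  simp [uniform, hk]

theorem ne_zero_of_mem_stdSimplex {k : ℕ} {p : Fin k → ℝ} (hp : p ∈ stdSimplex ℝ (Fin k)) :
    k ≠ 0 := by
  rintro rfl
  simpa using hp.2

end Iterate

end OMWU

theorem theorem2 {n m : ℕ} (A : Matrix (Fin n) (Fin m) ℝ)
    (xs : Fin n → ℝ) (ys : Fin m → ℝ)
    (hopt : OMWU.IsOptimal A xs ys)
    (huniq : ∀ x y, OMWU.IsOptimal A x y → x = xs ∧ y = ys) :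
    (∃ η₀ : ℝ, 0 < η₀ ∧ ∀ η : ℝ, 0 < η → η < η₀ →
      Tendsto
        (OMWU.iterate A η (OMWU.uniform n, OMWU.uniform m) (OMWU.uniform n, OMWU.uniform m))
        atTop (𝓝 (xs, ys))) ∧
    (∀ x0 ∈ OMWU.simplexInterior n, ∀ x1 ∈ OMWU.simplexInterior n,
      ∀ y0 ∈ OMWU.simplexInterior m, ∀ y1 ∈ OMWU.simplexInterior m,
      ∃ η₀ : ℝ, 0 < η₀ ∧ ∀ η : ℝ, 0 < η → η < η₀ →
        Tendsto (OMWU.iterate A η (x0, y0) (x1, y1)) atTop (𝓝 (xs, ys))) := by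
  obtain ⟨η₀, hη₀, h⟩ := OMWU.exists_stepsize_forall_tendsto_iterate A hopt huniq
  have hu : OMWU.uniform n ∈ OMWU.simplexInterior n ∧ OMWU.uniform m ∈ OMWU.simplexInterior m :=
    ⟨OMWU.uniform_mem_simplexInterior (OMWU.ne_zero_of_mem_stdSimplex hopt.left_mem),
      OMWU.uniform_mem_simplexInterior (OMWU.ne_zero_of_mem_stdSimplex hopt.right_mem)⟩
  exact ⟨⟨η₀, hη₀, fun η hη hlt => h η hη hlt _ _ hu hu⟩,
    fun x0 hx0 x1 hx1 y0 hy0 y1 hy1 =>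
      ⟨η₀, hη₀, fun η hη hlt => h η hη hlt _ _ ⟨hx0, hy0⟩ ⟨hx1, hy1⟩⟩⟩
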